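/- Let $\mathbb K\in\{\mathbb R,\mathbb C\}$, let $\mathcal H,\mathcal H'$ be Hilbert spaces over $\mathbb K$ (of any dimension), let $\mathcal R$ be a nonempty, possibly infinite set, and let $(a_x)_{x\in\mathcal R}\subset\mathcal H$ and $(b_x)_{x\in\mathcal R}\subset\mathcal H'$ be families of unit vectors, with Gram kernels $k_a(x,x')=\langle a_x,a_{x'}\rangle$ and $k_b(x,x')=\langle b_x,b_{x'}\rangle$. Write $\mathcal K^*(\mathcal H)$ for the space of trace-class operators on $\mathcal H$, and $aa^*$ for the operator $h\mapsto\langle a,h\rangle a$. A linear map $\Phi:\mathcal K^*(\mathcal H)\to\mathcal K^*(\mathcal H')$ is called CPTP if $\mathrm{tr}\,\Phi(A)=\mathrm{tr}\,A$ for all $A\in\mathcal K^*(\mathcal H)$ and if, for every $n$, the map $I_n\otimes\Phi$, from the trace-class operators on $\mathbb K^n\otimes\mathcal H$ to those on $\mathbb K^n\otimes\mathcal H'$, takes positive (Hermitian positive semidefinite) operators to positive operators. A function $k:\mathcal R\times\mathcal R\to\mathbb K$ is called a positive definite kernel if it is Hermitian (symmetric if $\mathbb K=\mathbb R$) and $\sum_{x,x'}\overline{c_x}\,k(x,x')\,c_{x'}\ge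 0$ for all finitely supported $c:\mathcal R\to\mathbb K$. Then there exists a CPTP map $\Phi:\mathcal K^*(\mathcal H)\to\mathcal K^*(\mathcal H')$ with $\Phi(a_xa_x^*)=b_xb_x^*$ for all $x\in\mathcal R$ if and only if there is a positive definite kernel $\tilde k$ on $\mathcal R$ with $k_a(x,x')=k_b(x,x')\,\tilde k(x,x')$ for all $x,x'\in\mathcal R$. Moreover, every such $\tilde k$ satisfies $\tilde k(x,x)=1$ for all $x\in\mathcal R$, and, for any topology on $\mathcal R$ for which $k_a$ and $k_b$ are continuous on $\mathcal R\times\mathcal R$, it is continuous on $\mathcal R\times\mathcal R$. -/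

import Mathlib

open scoped InnerProductSpace ComplexOrder

noncomputable section

namespace CPTPKernel

variable {𝕜 : Type*} [RCLike 𝕜]
variable {H : Type*} [NormedAddCommGroup H] [InnerProductSpace 𝕜 H]
variable {H' : Type*} [NormedAddCommGroup H'] [InnerProductSpace 𝕜 H']

/-- A bounded operator `A` on a Hilbert space is trace-class (nuclear) if it is a sum
`A = ∑ₙ ⟨fₙ, ·⟩ gₙ` of rank-one operators with `∑ₙ ‖fₙ‖ ‖gₙ‖ < ∞`. -/
def IsTraceClass (A : H →L[𝕜] H) : Prop :=
  ∃ f g : ℕ → H, Summable (fun n => ‖f n‖ * ‖g n‖) ∧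
    HasSum (fun n => InnerProductSpace.rankOne 𝕜 (g n) (f n)) A

theorem isTraceClass_zero : IsTraceClass (0 : H →L[𝕜] H) :=
  ⟨0, 0, by simp, by simp⟩

theorem IsTraceClass.add {A B : H →L[𝕜] H} (hA : IsTraceClass A) (hB : IsTraceClass B) :
    IsTraceClass (A + B) := by
  obtain ⟨f, g, hs, h⟩ := hA
  obtain ⟨f', g', hs', h'⟩ := hB
  have hs1 : Summable (fun s : ℕ ⊕ ℕ => ‖Sum.elim f f' s‖ * ‖Sum.elim g g' s‖) := by
    refine HasSum.summable (HasSum.sum (a := ∑' n, ‖f n‖ * ‖g n‖) (b := ∑' n, ‖f' n‖ * ‖g' n‖) ?_ ?_)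
    · exact hs.hasSum
    · exact hs'.hasSum
  have h1 : HasSum (fun s : ℕ ⊕ ℕ =>
      InnerProductSpace.rankOne 𝕜 (Sum.elim g g' s) (Sum.elim f f' s)) (A + B) := by
    refine HasSum.sum ?_ ?_
    · exact h
    · exact h'
  obtain ⟨e⟩ : Nonempty (ℕ ≃ ℕ ⊕ ℕ) := ⟨Equiv.natSumNatEquivNat.symm⟩
  have hs2 := hs1.comp_injective e.injective
  have h2 := (Equiv.hasSum_iff e).2 h1
  exact ⟨fun n => Sum.elim f f' (e n), fun n => Sum.elim g g' (e n), hs2, h2⟩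

theorem IsTraceClass.smul (c : 𝕜) {A : H →L[𝕜] H} (hA : IsTraceClass A) :
    IsTraceClass (c • A) := by
  obtain ⟨f, g, hs, h⟩ := hA
  refine ⟨f, fun n => c • g n, ?_, ?_⟩
  · refine (hs.mul_left ‖c‖).congr fun n => ?_
    rw [norm_smul]
    ring
  · simpa using h.const_smul c

theorem isTraceClass_rankOne (x y : H) :
    IsTraceClass (InnerProductSpace.rankOne 𝕜 x y) := by
  refine ⟨Pi.single 0 y, Pi.single 0 x, ?_, ?_⟩
  · refine summable_of_ne_finset_zero (s := {0}) fun n hn => ?_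
    have : n ≠ 0 := by simpa using hn
    simp [this]
  · convert hasSum_single (f := fun n : ℕ => InnerProductSpace.rankOne 𝕜
      ((Pi.single 0 x : ℕ → H) n) ((Pi.single 0 y : ℕ → H) n)) 0 ?_ using 1
    · simp
    · intro n hn
      simp [hn]

variable (𝕜 H) in
/-- The space of trace-class operators on `H`. -/
def traceClass : Submodule 𝕜 (H →L[𝕜] H) where
  carrier := {A | IsTraceClass A}
  zero_mem' := isTraceClass_zero
  add_mem' := IsTraceClass.add
  smul_mem' := fun c _ hA => hA.smul c

variable (𝕜) in
/-- The rank-one operator `a a*`, i.e. `h ↦ ⟨a, h⟩ a`, as a trace-class operator. -/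
def dyad (a : H) : traceClass 𝕜 H :=
  ⟨InnerProductSpace.rankOne 𝕜 a a, isTraceClass_rankOne a a⟩

variable (𝕜 H) in
/-- Some Hilbert basis of `H`; the trace does not depend on it, see `hasSum_trace`. -/
def stdBasis [CompleteSpace H] :
    HilbertBasis (Classical.choose (exists_hilbertBasis 𝕜 H) : Set H) 𝕜 H :=
  Classical.choose (Classical.choose_spec (exists_hilbertBasis 𝕜 H))

/-- The trace `tr A = ∑ᵢ ⟨eᵢ, A eᵢ⟩` of an operator, `(eᵢ)` being a Hilbert basis. -/
def trace [CompleteSpace H] (A : H →L[𝕜] H) : 𝕜 :=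
  ∑' i, ⟪stdBasis 𝕜 H i, A (stdBasis 𝕜 H i)⟫_𝕜

theorem hasSum_inner_basis {A : H →L[𝕜] H} {f g : ℕ → H}
    (hs : Summable (fun n => ‖f n‖ * ‖g n‖))
    (hA : HasSum (fun n => InnerProductSpace.rankOne 𝕜 (g n) (f n)) A)
    {ι : Type*} (e : HilbertBasis ι 𝕜 H) :
    HasSum (fun i => ⟪e i, A (e i)⟫_𝕜) (∑' n, ⟪f n, g n⟫_𝕜) := by
  have hbound : ∀ (x y : H) (s : Finset ι),
      ∑ i ∈ s, ‖⟪x, e i⟫_𝕜 * ⟪e i, y⟫_𝕜‖ ≤ ‖x‖ * ‖y‖ := by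
    intro x y s
    have hx := e.orthonormal.sum_inner_products_le (s := s) x
    have hy := e.orthonormal.sum_inner_products_le (s := s) y
    have hcs := Finset.sum_mul_sq_le_sq_mul_sq s (fun i => ‖⟪e i, x⟫_𝕜‖) (fun i => ‖⟪e i, y⟫_𝕜‖)
    have h0 : ∀ i ∈ s, ‖⟪x, e i⟫_𝕜 * ⟪e i, y⟫_𝕜‖ = ‖⟪e i, x⟫_𝕜‖ * ‖⟪e i, y⟫_𝕜‖ := by
      intro i _
      rw [norm_mul, norm_inner_symm x]
    rw [Finset.sum_congr rfl h0]
    refine abs_le_of_sq_le_sq' ?_ (by positivity) |>.2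
    calc _ ≤ _ := hcs
      _ ≤ ‖x‖ ^ 2 * ‖y‖ ^ 2 := by gcongr
      _ = _ := by ring
  have hsum : Summable (fun p : ℕ × ι => ⟪f p.1, e p.2⟫_𝕜 * ⟪e p.2, g p.1⟫_𝕜) := by
    refine Summable.of_norm ((summable_prod_of_nonneg fun p => norm_nonneg _).2 ⟨fun n => ?_, ?_⟩)
    · exact summable_of_sum_le (fun _ => norm_nonneg _) (hbound (f n) (g n))
    · refine Summable.of_nonneg_of_le (fun n => tsum_nonneg fun _ => norm_nonneg _) (fun n => ?_) hs
      exact Real.tsum_le_of_sum_le (fun _ => norm_nonneg _) (hbound (f n) (g n))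
  have h1 : ∀ n, HasSum (fun i => ⟪f n, e i⟫_𝕜 * ⟪e i, g n⟫_𝕜) ⟪f n, g n⟫_𝕜 :=
    fun n => e.hasSum_inner_mul_inner _ _
  have h2 : ∀ i, HasSum (fun n => ⟪f n, e i⟫_𝕜 * ⟪e i, g n⟫_𝕜) ⟪e i, A (e i)⟫_𝕜 := by
    intro i
    have := (hA.mapL (ContinuousLinearMap.apply 𝕜 H (e i))).mapL (innerSL 𝕜 (e i))
    simpa [inner_smul_right] using this
  have h3 := hsum.hasSum.prod_fiberwise h1
  have h4 : HasSum (fun p : ι × ℕ => ⟪f p.2, e p.1⟫_𝕜 * ⟪e p.1, g p.2⟫_𝕜) _ :=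
    ((Equiv.prodComm ι ℕ).hasSum_iff).2 hsum.hasSum
  rw [h3.tsum_eq]
  exact h4.prod_fiberwise h2

theorem hasSum_trace [CompleteSpace H] {A : H →L[𝕜] H} (hA : IsTraceClass A)
    {ι : Type*} (e : HilbertBasis ι 𝕜 H) :
    HasSum (fun i => ⟪e i, A (e i)⟫_𝕜) (trace A) := by
  obtain ⟨f, g, hs, h⟩ := hA
  have h1 := hasSum_inner_basis hs h e
  have h2 := hasSum_inner_basis hs h (stdBasis 𝕜 H)
  rw [trace, h2.tsum_eq]
  exact h1

/-- The operator on `Hⁿ = 𝕜ⁿ ⊗ H` with blocks `A i j`, i.e. `∑ᵢⱼ Eᵢⱼ ⊗ A i j`. Every operator on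
`𝕜ⁿ ⊗ H` is of this form; it is trace-class if and only if all its blocks are. -/
def blockOp {n : ℕ} (A : Fin n → Fin n → H →L[𝕜] H) :
    PiLp 2 (fun _ : Fin n => H) →L[𝕜] PiLp 2 (fun _ : Fin n => H) :=
  (PiLp.continuousLinearEquiv 2 𝕜 (fun _ : Fin n => H)).symm.toContinuousLinearMap ∘L
    ContinuousLinearMap.pi fun i => ∑ j, A i j ∘L PiLp.proj 2 (fun _ : Fin n => H) j

/-- `Φ` is completely positive: for every `n`, the map `Iₙ ⊗ Φ`, which applies `Φ` to each block of
an operator on `𝕜ⁿ ⊗ H` with trace-class blocks, takes positive operators to positive operators. -/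
def IsCompletelyPositive (Φ : traceClass 𝕜 H →ₗ[𝕜] traceClass 𝕜 H') : Prop :=
  ∀ (n : ℕ) (A : Fin n → Fin n → traceClass 𝕜 H),
    (blockOp fun i j => (A i j : H →L[𝕜] H)).IsPositive →
      (blockOp fun i j => (Φ (A i j) : H' →L[𝕜] H')).IsPositive

def IsTracePreserving [CompleteSpace H] [CompleteSpace H']
    (Φ : traceClass 𝕜 H →ₗ[𝕜] traceClass 𝕜 H') : Prop :=
  ∀ A : traceClass 𝕜 H, trace (Φ A : H' →L[𝕜] H') = trace (A : H →L[𝕜] H)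

/-- Completely positive trace-preserving maps between spaces of trace-class operators. -/
def IsCPTP [CompleteSpace H] [CompleteSpace H']
    (Φ : traceClass 𝕜 H →ₗ[𝕜] traceClass 𝕜 H') : Prop :=
  IsCompletelyPositive Φ ∧ IsTracePreserving Φ

/-- `k` is a positive definite kernel on the set `R`: it is Hermitian (symmetric if `𝕜 = ℝ`), and
`∑ₓᵧ conj (c x) * k x y * c y ≥ 0` for all finitely supported coefficients `c`. -/
def IsPosDefKernel {R : Type*} (k : R → R → 𝕜) : Prop :=
  (Matrix.of k).PosSemidef

end CPTPKernel

end

namespace CPTPKernel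

variable {𝕜 : Type*} [RCLike 𝕜]
variable {H : Type*} [NormedAddCommGroup H] [InnerProductSpace 𝕜 H]
variable {H' : Type*} [NormedAddCommGroup H'] [InnerProductSpace 𝕜 H']

open InnerProductSpace

/-! Sufficiency: factor the kernel as `⟪c x, c y⟫` with `c x` in an ℓ² space. Then `a x ↦ b x ⊗ c x`
preserves inner products and extends to an isometry on the closed span of the `a x`. Its coordinates
are Kraus operators taking `a x` to `c x i • b x`, so `a x a x*` goes to `‖c x‖² b x b x* = b x b
x*`; extra operators supported on the orthogonal complement restore the trace
(`exists_partial_isometry_of_inner_eq`, `isKrausFamily_sumElim`).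

Necessity: `Iₙ ⊗ Φ` keeps the block operator `(aᵢ aⱼ*)` positive. Its diagonal blocks become `bᵢ
bᵢ*`, which forces the others to be multiples of `bᵢ bⱼ*` (`eq_smul_rankOne_of_blockOp_isPositive`).
The multiples form the kernel, and traces give the factorization.

Continuity: `kb` is nonzero near the diagonal, so there the kernel is a quotient tending to 1; this
makes the feature map `c` continuous, hence the kernel everywhere. -/

/-! ### Nuclear expansions over arbitrary index sets -/

theorem hasSum_extend_zero_bilin {ι E : Type*} [AddCommMonoid E] [TopologicalSpace E]
    {f g : ι → H} {s : Set ι} (hz : ∀ i ∉ s, f i = 0 ∨ g i = 0) {e : s → ℕ}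
    (he : Function.Injective e) (B : H → H → E) (h1 : ∀ x, B x 0 = 0) (h2 : ∀ x, B 0 x = 0)
    (c : E) :
    HasSum (fun n => B (Function.extend e (fun i : s => f i) 0 n)
      (Function.extend e (fun i : s => g i) 0 n)) c ↔ HasSum (fun i => B (f i) (g i)) c := by
  have : (fun n => B (Function.extend e (fun i : s => f i) 0 n)
      (Function.extend e (fun i : s => g i) 0 n)) =
      Function.extend e (fun i : s => B (f i) (g i)) 0 := by
    ext n
    by_cases h : ∃ i, e i = n
    · obtain ⟨i, rfl⟩ := h
      simp only [he.extend_apply]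
    · simp only [Function.extend_apply' _ _ _ h, Pi.zero_apply, h1]
  rw [this, hasSum_extend_zero he]
  refine hasSum_subtype_iff_of_support_subset (f := fun i => B (f i) (g i)) fun i hi => ?_
  by_contra hi'
  rcases hz i hi' with h | h <;> simp [h, h1, h2] at hi

/-- A summable family has countable support, so it can be moved into `ℕ` and padded with zeros. -/
theorem exists_nat_reindex_rankOne {ι : Type*} {f g : ι → H} {A : H →L[𝕜] H}
    (hs : Summable fun i => ‖f i‖ * ‖g i‖) (hA : HasSum (fun i => rankOne 𝕜 (g i) (f i)) A) :
    ∃ F G : ℕ → H, (Summable fun n => ‖F n‖ * ‖G n‖) ∧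
      HasSum (fun n => rankOne 𝕜 (G n) (F n)) A ∧
      ∀ c : 𝕜, HasSum (fun n => ⟪F n, G n⟫_𝕜) c ↔ HasSum (fun i => ⟪f i, g i⟫_𝕜) c := by
  have hz : ∀ i ∉ Function.support fun i => ‖f i‖ * ‖g i‖, f i = 0 ∨ g i = 0 := by
    intro i hi
    simpa [or_iff_not_imp_left] using hi
  have hcount := hs.countable_support.to_subtype
  obtain ⟨e, he⟩ := exists_injective_nat (Function.support fun i => ‖f i‖ * ‖g i‖)
  refine ⟨Function.extend e (fun i => f i) 0, Function.extend e (fun i => g i) 0, ?_, ?_, ?_⟩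
  · obtain ⟨c, hc⟩ := hs
    exact ⟨c, (hasSum_extend_zero_bilin hz he (fun x y => ‖x‖ * ‖y‖) (by simp) (by simp) c).2 hc⟩
  · exact (hasSum_extend_zero_bilin hz he (fun x y => rankOne 𝕜 y x) (by simp) (by simp) A).2 hA
  · exact hasSum_extend_zero_bilin hz he (fun x y => ⟪x, y⟫_𝕜) (by simp) (by simp)

theorem isTraceClass_of_hasSum {ι : Type*} {f g : ι → H} {A : H →L[𝕜] H}
    (hs : Summable fun i => ‖f i‖ * ‖g i‖) (hA : HasSum (fun i => rankOne 𝕜 (g i) (f i)) A) :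
    IsTraceClass A := by
  obtain ⟨F, G, h1, h2, -⟩ := exists_nat_reindex_rankOne hs hA
  exact ⟨F, G, h1, h2⟩

theorem trace_eq_of_hasSum [CompleteSpace H] {ι : Type*} {f g : ι → H} {A : H →L[𝕜] H}
    (hs : Summable fun i => ‖f i‖ * ‖g i‖) (hA : HasSum (fun i => rankOne 𝕜 (g i) (f i)) A)
    {c : 𝕜} (hc : HasSum (fun i => ⟪f i, g i⟫_𝕜) c) : trace A = c := by
  obtain ⟨F, G, h1, h2, h3⟩ := exists_nat_reindex_rankOne hs hA
  rw [trace, (hasSum_inner_basis h1 h2 (stdBasis 𝕜 H)).tsum_eq, ((h3 c).2 hc).tsum_eq]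

theorem trace_rankOne [CompleteSpace H] (x y : H) : trace (rankOne 𝕜 x y) = ⟪y, x⟫_𝕜 :=
  trace_eq_of_hasSum (ι := Unit) (f := fun _ => y) (g := fun _ => x) (hasSum_unique _).summable
    (hasSum_unique _) (hasSum_unique _)

/-! ### Positivity of block operators -/

theorem inner_blockOp {n : ℕ} (A : Fin n → Fin n → H →L[𝕜] H) (x y : PiLp 2 fun _ : Fin n => H) :
    ⟪x, blockOp A y⟫_𝕜 = ∑ i, ∑ j, ⟪x i, A i j (y j)⟫_𝕜 := by
  simp [blockOp, PiLp.inner_apply, inner_sum]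

/-- Symmetry is a separate condition because over `ℝ` it does not follow from nonnegativity of the
quadratic form. -/
theorem blockOp_isPositive_iff {n : ℕ} (A : Fin n → Fin n → H →L[𝕜] H) :
    (blockOp A).IsPositive ↔
      (∀ i j x y, ⟪A i j x, y⟫_𝕜 = ⟪x, A j i y⟫_𝕜) ∧
        ∀ v : Fin n → H, 0 ≤ RCLike.re (∑ i, ∑ j, ⟪v i, A i j (v j)⟫_𝕜) := by
  constructor
  · intro h
    refine ⟨fun i j x y => ?_, fun v => ?_⟩
    · have := h.isSymmetric (PiLp.single 2 j x) (PiLp.single 2 i y)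
      rw [← inner_conj_symm] at this
      simp only [ContinuousLinearMap.coe_coe, inner_blockOp] at this
      rw [Finset.sum_eq_single i, Finset.sum_eq_single j, Finset.sum_eq_single j,
        Finset.sum_eq_single i] at this <;> simp_all
    · have := h.re_inner_nonneg_right (WithLp.toLp 2 v)
      rwa [inner_blockOp] at this
  · rintro ⟨h1, h2⟩
    refine ⟨fun x y => ?_, fun x => ?_⟩
    · rw [← inner_conj_symm]
      simp only [ContinuousLinearMap.coe_coe, inner_blockOp, map_sum, inner_conj_symm, h1]
      exact Finset.sum_comm
    · have := h2 x
      rw [← inner_blockOp, inner_re_symm] at this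
      exact this

/-! ### Kraus families define CPTP maps -/

/-- The operators `V i` assemble to an isometry `h ↦ (V i h)ᵢ` into the Hilbert sum. -/
def IsKrausFamily {ι : Type*} (V : ι → H →L[𝕜] H') : Prop :=
  ∀ h, HasSum (fun i => ‖V i h‖ ^ 2) (‖h‖ ^ 2)

namespace IsKrausFamily

variable {ι : Type*} {V : ι → H →L[𝕜] H'}

/-- Polarization of the norm identity. -/
theorem hasSum_inner (hV : IsKrausFamily V) (x y : H) :
    HasSum (fun i => ⟪V i x, V i y⟫_𝕜) ⟪x, y⟫_𝕜 := by
  have h : ∀ h, HasSum (fun i => (‖V i h‖ : 𝕜) ^ 2) ((‖h‖ : 𝕜) ^ 2) := fun h => by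
    simpa using (hV h).mapL (RCLike.ofRealCLM : ℝ →L[ℝ] 𝕜)
  simp only [inner_eq_sum_norm_sq_div_four, ← map_smul, ← map_add, ← map_sub]
  exact (((h _).sub (h _)).add (((h _).sub (h _)).mul_right _)).div_const _

theorem sum_norm_mul_norm_le (hV : IsKrausFamily V) (x y : H) (s : Finset ι) :
    ∑ i ∈ s, ‖V i x‖ * ‖V i y‖ ≤ ‖x‖ * ‖y‖ := by
  refine abs_le_of_sq_le_sq' ?_ (by positivity) |>.2
  have hle : ∀ h, ∑ i ∈ s, ‖V i h‖ ^ 2 ≤ ‖h‖ ^ 2 := fun h =>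
    sum_le_hasSum s (fun _ _ => by positivity) (hV h)
  calc _ ≤ (∑ i ∈ s, ‖V i x‖ ^ 2) * ∑ i ∈ s, ‖V i y‖ ^ 2 := Finset.sum_mul_sq_le_sq_mul_sq ..
    _ ≤ ‖x‖ ^ 2 * ‖y‖ ^ 2 := by gcongr <;> exact hle _
    _ = _ := by ring

theorem summable_norm_mul_norm (hV : IsKrausFamily V) {f g : ℕ → H}
    (hs : Summable fun n => ‖f n‖ * ‖g n‖) :
    Summable fun p : ℕ × ι => ‖V p.2 (f p.1)‖ * ‖V p.2 (g p.1)‖ := by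
  refine (summable_prod_of_nonneg fun p => by positivity).2 ⟨fun n => ?_, ?_⟩
  · exact summable_of_sum_le (fun _ => by positivity) (hV.sum_norm_mul_norm_le (f n) (g n))
  · refine Summable.of_nonneg_of_le (fun n => tsum_nonneg fun _ => by positivity) (fun n => ?_) hs
    exact Real.tsum_le_of_sum_le (fun _ => by positivity) (hV.sum_norm_mul_norm_le (f n) (g n))

variable [CompleteSpace H] [CompleteSpace H']

/-- The double family over `ℕ × ι` is absolutely summable, so it may be summed over `n` first, for
each fixed `i`. -/
theorem hasSum_conj (hV : IsKrausFamily V) {A : H →L[𝕜] H} {f g : ℕ → H}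
    (hs : Summable fun n => ‖f n‖ * ‖g n‖) (hA : HasSum (fun n => rankOne 𝕜 (g n) (f n)) A) :
    HasSum (fun i => V i ∘L A ∘L (V i).adjoint)
      (∑' p : ℕ × ι, rankOne 𝕜 (V p.2 (g p.1)) (V p.2 (f p.1))) := by
  have hsum : Summable fun p : ℕ × ι => rankOne 𝕜 (V p.2 (g p.1)) (V p.2 (f p.1)) := by
    refine Summable.of_norm ((hV.summable_norm_mul_norm hs).congr fun p => ?_)
    rw [norm_rankOne, mul_comm]
  have h1 := ((Equiv.prodComm ι ℕ).hasSum_iff).2 hsum.hasSum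
  refine h1.prod_fiberwise fun i => ?_
  have h2 := (hA.mapL ((ContinuousLinearMap.compL 𝕜 H' H H).flip (V i).adjoint)).mapL
    (ContinuousLinearMap.compL 𝕜 H' H H' (V i))
  convert! h2 using 2 with n
  ext x
  simp [ContinuousLinearMap.adjoint_inner_right]

theorem summable_conj (hV : IsKrausFamily V) {A : H →L[𝕜] H} (hA : IsTraceClass A) :
    Summable fun i => V i ∘L A ∘L (V i).adjoint := by
  obtain ⟨f, g, hs, h⟩ := hA
  exact (hV.hasSum_conj hs h).summable

theorem tsum_conj (hV : IsKrausFamily V) {A : H →L[𝕜] H} (hA : IsTraceClass A) :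
    IsTraceClass (∑' i, V i ∘L A ∘L (V i).adjoint) ∧
      trace (∑' i, V i ∘L A ∘L (V i).adjoint) = trace A := by
  obtain ⟨f, g, hs, h⟩ := hA
  have hs' := hV.summable_norm_mul_norm hs
  have hsum : Summable fun p : ℕ × ι => rankOne 𝕜 (V p.2 (g p.1)) (V p.2 (f p.1)) := by
    refine Summable.of_norm (hs'.congr fun p => ?_)
    rw [norm_rankOne, mul_comm]
  rw [(hV.hasSum_conj hs h).tsum_eq]
  refine ⟨isTraceClass_of_hasSum hs' hsum.hasSum, trace_eq_of_hasSum hs' hsum.hasSum ?_⟩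
  have hinner : Summable fun p : ℕ × ι => ⟪V p.2 (f p.1), V p.2 (g p.1)⟫_𝕜 :=
    Summable.of_norm_bounded hs' fun p => norm_inner_le_norm _ _
  -- For the trace, the double family is summed over `i` first, where the Kraus identity applies.
  have h3 := hinner.hasSum.prod_fiberwise fun n => hV.hasSum_inner (f n) (g n)
  have h4 : HasSum (fun n => ⟪f n, g n⟫_𝕜) (trace A) := by
    rw [trace, (hasSum_inner_basis hs h (stdBasis 𝕜 H)).tsum_eq]
    exact h3.summable.hasSum
  rw [h4.unique h3]
  exact hinner.hasSum

/-- The map `A ↦ ∑ᵢ Vᵢ A Vᵢ*`. -/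
noncomputable def toMap (hV : IsKrausFamily V) : traceClass 𝕜 H →ₗ[𝕜] traceClass 𝕜 H' where
  toFun A := ⟨∑' i, V i ∘L (A : H →L[𝕜] H) ∘L (V i).adjoint, (hV.tsum_conj A.2).1⟩
  map_add' A B := by
    ext1
    simp only [Submodule.coe_add, ContinuousLinearMap.comp_add, ContinuousLinearMap.add_comp]
    exact (hV.summable_conj A.2).tsum_add (hV.summable_conj B.2)
  map_smul' c A := by
    ext1
    simp only [Submodule.coe_smul, ContinuousLinearMap.comp_smul, ContinuousLinearMap.smul_comp]
    exact (hV.summable_conj A.2).tsum_const_smul c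

theorem hasSum_toMap (hV : IsKrausFamily V) (A : traceClass 𝕜 H) :
    HasSum (fun i => V i ∘L (A : H →L[𝕜] H) ∘L (V i).adjoint) (hV.toMap A : H' →L[𝕜] H') :=
  (hV.summable_conj A.2).hasSum

theorem hasSum_inner_toMap (hV : IsKrausFamily V) (A : traceClass 𝕜 H) (x y : H') :
    HasSum (fun i => ⟪(V i).adjoint x, (A : H →L[𝕜] H) ((V i).adjoint y)⟫_𝕜)
      ⟪x, (hV.toMap A : H' →L[𝕜] H') y⟫_𝕜 := by
  have := ((hV.hasSum_toMap A).mapL (ContinuousLinearMap.apply 𝕜 H' y)).mapL (innerSL 𝕜 x)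
  simpa [ContinuousLinearMap.adjoint_inner_left] using this

theorem isCPTP_toMap (hV : IsKrausFamily V) : IsCPTP hV.toMap := by
  refine ⟨fun n A hA => ?_, fun A => (hV.tsum_conj A.2).2⟩
  rw [blockOp_isPositive_iff] at hA ⊢
  refine ⟨fun i j x y => ?_, fun v => ?_⟩
  · have h1 := (hV.hasSum_inner_toMap (A i j) y x).mapL (RCLike.conjCLE (K := 𝕜)).toContinuousLinearMap
    have h2 := hV.hasSum_inner_toMap (A j i) x y
    rw [← inner_conj_symm]
    refine HasSum.unique (by simpa using h1) (h2.congr_fun ?_)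
    intro k
    simpa using hA.1 i j _ _
  · have h := hasSum_sum fun i (_ : i ∈ Finset.univ) => hasSum_sum
      fun j (_ : j ∈ Finset.univ) => hV.hasSum_inner_toMap (A i j) (v i) (v j)
    -- The `k`-th term is the form of `A` at the vectors `(V k)* (v i)`.
    exact (RCLike.hasSum_re _ h).nonneg fun k => hA.2 fun i => (V k).adjoint (v i)

end IsKrausFamily

/-! ### Isometric extension and feature maps -/

theorem exists_partial_isometry_of_inner_eq [CompleteSpace H] [CompleteSpace H'] {R : Type*}
    {a : R → H} {w : R → H'} (h : ∀ x y, ⟪w x, w y⟫_𝕜 = ⟪a x, a y⟫_𝕜) :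
    ∃ (W : H →L[𝕜] H') (Q : H →L[𝕜] H), (∀ x, W (a x) = w x) ∧ (∀ x, Q (a x) = 0) ∧
      ∀ v, ‖W v‖ ^ 2 + ‖Q v‖ ^ 2 = ‖v‖ ^ 2 := by
  set M := (Submodule.span 𝕜 (Set.range a)).topologicalClosure with hM
  have : CompleteSpace M := (Submodule.isClosed_topologicalClosure _).completeSpace_coe
  have ha : ∀ x, a x ∈ M := fun x =>
    Submodule.le_topologicalClosure _ (Submodule.subset_span ⟨x, rfl⟩)
  have hr : ∀ v, Finsupp.linearCombination 𝕜 a v ∈ M := fun v =>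
    Submodule.le_topologicalClosure _ (Finsupp.range_linearCombination 𝕜 (v := a) ▸ ⟨v, rfl⟩)
  set S := (Finsupp.linearCombination 𝕜 a).codRestrict M hr
  set T := Finsupp.linearCombination 𝕜 w
  have hn : ∀ v, ‖T v‖ = ‖S v‖ := by
    intro v
    have : ⟪T v, T v⟫_𝕜 = ⟪S v, S v⟫_𝕜 := by
      rw [Submodule.coe_inner]
      simp only [S, T, LinearMap.codRestrict_apply, Finsupp.linearCombination_apply, Finsupp.sum,
        sum_inner, inner_sum, inner_smul_left, inner_smul_right, h]
    rw [@norm_eq_sqrt_re_inner 𝕜, this, ← @norm_eq_sqrt_re_inner 𝕜]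
  have hd : DenseRange S := by
    intro ⟨y, hy⟩
    rw [closure_subtype]
    rw [← Set.range_comp]
    have h2 : Set.range (Subtype.val ∘ S) = Submodule.span 𝕜 (Set.range a) := by
      rw [← Finsupp.range_linearCombination]
      rfl
    rw [h2]
    exact hy
  -- By this bound `T` depends only on the value of `S`, and extends from its dense range to `M`.
  have hb : ∀ v, ‖T v‖ ≤ 1 * ‖S v‖ := fun v => by rw [hn, one_mul]
  have hW : ∀ v, T.extendOfNorm S (S v) = T v := LinearMap.extendOfNorm_eq hd ⟨1, hb⟩
  have hWn : ∀ m, ‖T.extendOfNorm S m‖ = ‖m‖ := by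
    refine hd.induction ?_ (isClosed_eq (by fun_prop) (by fun_prop))
    rintro _ ⟨v, rfl⟩
    rw [hW, hn]
  refine ⟨T.extendOfNorm S ∘L M.orthogonalProjectionOnto, Mᗮ.starProjection, fun x => ?_,
    fun x => ?_, fun v => ?_⟩
  · have h1 : M.orthogonalProjectionOnto (a x) = S (Finsupp.single x 1) := by
      rw [Submodule.orthogonalProjectionOnto_mem_subspace_eq_self (⟨a x, ha x⟩ : M)]
      ext
      simp [S]
    simp [h1, hW, T]
  · simp [Submodule.starProjection_eq_self_iff.2 (ha x)]
  · simp [hWn, M.norm_sq_eq_add_norm_sq_projection v]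

/-- Kernel functions of the reproducing kernel Hilbert space, in coordinates of a Hilbert basis. -/
theorem exists_feature_map.{u, v} {𝕜 : Type u} [RCLike 𝕜] {R : Type v} {k : R → R → 𝕜}
    (hk : IsPosDefKernel k) :
    ∃ (ι : Type (max u v)) (c : R → lp (fun _ : ι => 𝕜) 2), ∀ x y, ⟪c x, c y⟫_𝕜 = k x y := by
  have hherm : ∀ x y, starRingEnd 𝕜 (k y x) = k x y := fun x y => hk.1.apply x y
  set K : Matrix R R (𝕜 →L[𝕜] 𝕜) := Matrix.of fun x y => k x y • (1 : 𝕜 →L[𝕜] 𝕜)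
  have hK : K.PosSemidef := by
    have tfae := (RKHS.posSemidef_tfae (K := K)).out 0 2
    refine tfae.2 ⟨?_, fun v => ?_⟩
    · ext x y
      simp [K, ← hherm x y, star_smul]
    · have := (RCLike.nonneg_iff.1 (hk.2 v)).1
      refine this.trans_eq (congrArg _ (Finset.sum_congr rfl fun i _ =>
        Finset.sum_congr rfl fun j _ => ?_))
      simp [K, hherm]
      ring
  have : Fact K.PosSemidef := ⟨hK⟩
  obtain ⟨s, e, -⟩ := exists_hilbertBasis 𝕜 (RKHS.OfKernel K)
  refine ⟨s, fun x => e.repr (RKHS.kerFun (RKHS.OfKernel K) x 1), fun x y => ?_⟩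
  rw [e.repr.inner_map_map, ← RKHS.kernel_inner, RKHS.OfKernel.kernel_ofKernel]
  simp [K, hherm]

theorem continuous_of_inner_eq {R : Type*} [TopologicalSpace R] {c : R → H}
    {ka kb kt : R → R → 𝕜} (hc : ∀ x y, ⟪c x, c y⟫_𝕜 = kt x y) (ht : ∀ x, kt x x = 1)
    (hb : ∀ x, kb x x = 1) (h : ∀ x y, ka x y = kb x y * kt x y)
    (hka : Continuous fun p : R × R => ka p.1 p.2) (hkb : Continuous fun p : R × R => kb p.1 p.2) :
    Continuous fun p : R × R => kt p.1 p.2 := by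
  have hcont : Continuous c := by
    -- Here `‖c x - c y‖² = 2 - 2 Re kt x y`, so only the limit of `kt` at the diagonal matters.
    refine continuous_iff_continuousAt.2 fun y => tendsto_iff_norm_sub_tendsto_zero.2 ?_
    have h1 : Filter.Tendsto (fun x => kt x y) (nhds y) (nhds 1) := by
      have hb' : Filter.Tendsto (fun x => kb x y) (nhds y) (nhds 1) :=
        hb y ▸ (hkb.comp (.prodMk_left y)).tendsto y
      have ha' : Filter.Tendsto (fun x => ka x y) (nhds y) (nhds 1) := by
        have hy : ka y y = 1 := by simp [h, hb, ht]
        exact hy ▸ (hka.comp (.prodMk_left y)).tendsto y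
      have hq := ha'.div hb' one_ne_zero
      rw [div_one] at hq
      refine hq.congr' ?_
      filter_upwards [hb'.eventually_ne one_ne_zero] with x hx
      rw [Pi.div_apply, h, mul_div_cancel_left₀ _ hx]
    have hn : ∀ x, ‖c x‖ = 1 := fun x => by
      rw [@norm_eq_sqrt_re_inner 𝕜, hc, ht]; simp
    have h2 : ∀ x, ‖c x - c y‖ = √(2 - 2 * RCLike.re (kt x y)) := fun x => by
      rw [← Real.sqrt_sq (norm_nonneg (c x - c y)), @norm_sub_sq 𝕜, hn, hn, hc]
      ring_nf
    simp_rw [h2]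
    have h3 := (((RCLike.continuous_re.tendsto _).comp h1).const_mul 2).const_sub 2 |>.sqrt
    simpa using h3
  simp_rw [← hc]
  fun_prop

/-! ### Sufficiency: constructing the map -/

/-- The operators `b eⱼ* Q` supply the missing mass `‖Q v‖²`, by Parseval. -/
theorem isKrausFamily_sumElim [CompleteSpace H] {ι κ : Type*}
    {W : H →L[𝕜] lp (fun _ : ι => H') 2} {Q : H →L[𝕜] H} (e : HilbertBasis κ 𝕜 H) {b : H'}
    (hb : ‖b‖ = 1) (h : ∀ v, ‖W v‖ ^ 2 + ‖Q v‖ ^ 2 = ‖v‖ ^ 2) :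
    IsKrausFamily (Sum.elim (fun i => lp.evalCLM 𝕜 (fun _ : ι => H') 2 i ∘L W)
      fun j => rankOne 𝕜 b (e j) ∘L Q) := by
  intro v
  rw [← h v]
  refine HasSum.sum ?_ ?_
  · simpa using! (lp.hasSum_norm (by simp) (W v))
  · have := lp.hasSum_norm (by simp) (e.repr (Q v))
    simpa [Function.comp_def, norm_smul, hb, e.repr_apply_apply] using! this

theorem exists_isCPTP_of_inner_eq_mul [CompleteSpace H] [CompleteSpace H'] {R : Type*} [Nonempty R]
    {a : R → H} {b : R → H'} (hb : ∀ x, ‖b x‖ = 1) {ι : Type*} {c : R → lp (fun _ : ι => 𝕜) 2}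
    (hc : ∀ x, ‖c x‖ = 1) (h : ∀ x y, ⟪a x, a y⟫_𝕜 = ⟪b x, b y⟫_𝕜 * ⟪c x, c y⟫_𝕜) :
    ∃ Φ : traceClass 𝕜 H →ₗ[𝕜] traceClass 𝕜 H',
      IsCPTP Φ ∧ ∀ x, Φ (dyad 𝕜 (a x)) = dyad 𝕜 (b x) := by
  have hmem : ∀ x, Memℓp (fun i => c x i • b x) 2 := fun x => by
    refine (memℓp_gen_iff (by simp)).2 ?_
    simpa [norm_smul, hb] using (lp.hasSum_norm (by simp) (c x)).summable
  -- This is `b x ⊗ c x`, viewed in the Hilbert sum of copies of `H'`.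
  set w : R → lp (fun _ : ι => H') 2 := fun x => ⟨fun i => c x i • b x, hmem x⟩
  have hw : ∀ x y, ⟪w x, w y⟫_𝕜 = ⟪a x, a y⟫_𝕜 := fun x y => by
    refine (lp.hasSum_inner (𝕜 := 𝕜) (w x) (w y)).unique ?_
    rw [h]
    convert! (lp.hasSum_inner (𝕜 := 𝕜) (c x) (c y)).mul_left _ using 2 with i
    simp [w, inner_smul_left, inner_smul_right]
    ring
  obtain ⟨W, Q, hW, hQ, hn⟩ := exists_partial_isometry_of_inner_eq hw
  have hV := isKrausFamily_sumElim (stdBasis 𝕜 H) (hb (Classical.arbitrary R)) hn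
  refine ⟨hV.toMap, hV.isCPTP_toMap, fun x => Subtype.ext ?_⟩
  refine (hV.hasSum_toMap _).unique ?_
  rw [← add_zero (dyad 𝕜 (b x) : H' →L[𝕜] H')]
  refine HasSum.sum ?_ ?_
  · have h1 := (lp.hasSum_inner (𝕜 := 𝕜) (c x) (c x)).smul_const (rankOne 𝕜 (b x) (b x))
    rw [inner_self_eq_norm_sq_to_K, hc] at h1
    convert! h1 using 1
    · ext i z
      have heval : lp.evalCLM 𝕜 (fun _ : ι => H') 2 i (w x) = c x i • b x := rfl
      simp [dyad, hW, heval, ContinuousLinearMap.adjoint_inner_right, inner_smul_left, smul_smul,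
        ← RCLike.conj_mul]
      ring_nf
    · simp [dyad]
  · convert! hasSum_zero using 2 with j
    ext z
    simp [dyad, hQ, ContinuousLinearMap.adjoint_inner_right]

/-! ### Necessity: extracting the kernel -/

/-- At `u = B w`, `v = t w` the form is affine in `t` with slope `2‖B w‖²`, so it is bounded below
only if `B w = 0`. -/
theorem apply_eq_zero_of_forall_re_nonneg {A B C D : H →L[𝕜] H}
    (hBC : ∀ x y, ⟪B x, y⟫_𝕜 = ⟪x, C y⟫_𝕜)
    (h : ∀ u v, 0 ≤ RCLike.re (⟪u, A u⟫_𝕜 + ⟪u, B v⟫_𝕜 + (⟪v, C u⟫_𝕜 + ⟪v, D v⟫_𝕜)))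
    {w : H} (hw : D w = 0) : B w = 0 := by
  by_contra hne
  have hpos : 0 < ‖B w‖ ^ 2 := by positivity
  -- Chosen so that the form takes the value `-1`.
  set t := -(RCLike.re ⟪B w, A (B w)⟫_𝕜 + 1) / (2 * ‖B w‖ ^ 2) with ht
  have h1 := h (B w) ((t : 𝕜) • w)
  rw [map_smul, map_smul, hw, inner_smul_left, ← hBC, inner_smul_right, inner_self_eq_norm_sq_to_K,
    smul_zero, inner_zero_right, add_zero, RCLike.conj_ofReal, ← RCLike.ofReal_pow,
    ← RCLike.ofReal_mul, map_add, map_add, RCLike.ofReal_re] at h1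
  have h2 : t * (2 * ‖B w‖ ^ 2) = -(RCLike.re ⟪B w, A (B w)⟫_𝕜 + 1) :=
    div_mul_cancel₀ _ (by positivity)
  linarith

/-- Off-diagonal blocks of a positive operator whose diagonal blocks are `b b*` and `b' b'*`. -/
theorem eq_smul_rankOne_of_blockOp_isPositive {A : Fin 2 → Fin 2 → H →L[𝕜] H}
    (hA : (blockOp A).IsPositive) {b b' : H} (hb : ‖b‖ = 1) (hb' : ‖b'‖ = 1)
    (h0 : A 0 0 = rankOne 𝕜 b b) (h1 : A 1 1 = rankOne 𝕜 b' b') :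
    A 0 1 = ⟪b, A 0 1 b'⟫_𝕜 • rankOne 𝕜 b b' := by
  obtain ⟨hs, hp⟩ := (blockOp_isPositive_iff A).1 hA
  simp only [Fin.sum_univ_two] at hp
  have hz : ∀ w, ⟪b', w⟫_𝕜 = 0 → A 0 1 w = 0 := fun w hw =>
    apply_eq_zero_of_forall_re_nonneg (hs 0 1) (fun u v => hp ![u, v]) (by simp [h1, hw])
  have hz' : ∀ w, ⟪b, w⟫_𝕜 = 0 → A 1 0 w = 0 := fun w hw =>
    apply_eq_zero_of_forall_re_nonneg (hs 1 0)
      (fun u v => (hp ![v, u]).trans_eq (congrArg _ (by simp; ring))) (by simp [h0, hw])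
  have hsub : ∀ {d : H} (_ : ‖d‖ = 1) (x : H), ⟪d, x - ⟪d, x⟫_𝕜 • d⟫_𝕜 = 0 := fun hd x => by
    simp [inner_sub_right, inner_smul_right, inner_self_eq_norm_sq_to_K, hd]
  ext x
  have e1 : A 0 1 x = ⟪b', x⟫_𝕜 • A 0 1 b' := by
    simpa [sub_eq_zero] using hz _ (hsub hb' x)
  -- Since `A 1 0`, the adjoint block, kills the complement of `b`, the range of `A 0 1` lies in the
  -- span of `b`.
  have e2 : A 0 1 b' = ⟪b, A 0 1 b'⟫_𝕜 • b := by
    refine ext_inner_right 𝕜 fun y => ?_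
    have e3 : A 1 0 y = ⟪b, y⟫_𝕜 • A 1 0 b := by
      simpa [sub_eq_zero] using hz' _ (hsub hb y)
    rw [hs, e3, inner_smul_left, inner_smul_right, ← hs, inner_conj_symm, mul_comm]
  rw [e1]
  nth_rw 1 [e2]
  simp [smul_smul, mul_comm]

variable (𝕜) in
/-- The rank-one operator `x y*` as a trace-class operator. -/
noncomputable def ketBra (x y : H) : traceClass 𝕜 H :=
  ⟨rankOne 𝕜 x y, isTraceClass_rankOne x y⟩

/-- The quadratic form is `|∑ ⟪a i, v i⟫|²`. -/
theorem blockOp_rankOne_isPositive {n : ℕ} (a : Fin n → H) :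
    (blockOp fun i j => rankOne 𝕜 (a i) (a j)).IsPositive := by
  refine (blockOp_isPositive_iff _).2 ⟨fun i j x y => ?_, fun v => ?_⟩
  · simp [inner_smul_left, inner_smul_right, mul_comm]
  · have : ∑ i, ∑ j, ⟪v i, rankOne 𝕜 (a i) (a j) (v j)⟫_𝕜 =
        starRingEnd 𝕜 (∑ i, ⟪a i, v i⟫_𝕜) * ∑ i, ⟪a i, v i⟫_𝕜 := by
      simp only [map_sum, inner_conj_symm, Finset.sum_mul_sum, rankOne_apply, inner_smul_right]
      simp [mul_comm]
    rw [this, RCLike.conj_mul, ← RCLike.ofReal_pow, RCLike.ofReal_re]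
    positivity

theorem exists_isPosDefKernel_of_isCPTP [CompleteSpace H] [CompleteSpace H'] {R : Type*}
    {a : R → H} {b : R → H'} (hb : ∀ x, ‖b x‖ = 1)
    {Φ : traceClass 𝕜 H →ₗ[𝕜] traceClass 𝕜 H'} (hΦ : IsCPTP Φ)
    (h : ∀ x, Φ (dyad 𝕜 (a x)) = dyad 𝕜 (b x)) :
    ∃ kt : R → R → 𝕜, IsPosDefKernel kt ∧ ∀ x y, ⟪a x, a y⟫_𝕜 = ⟪b x, b y⟫_𝕜 * kt x y := by
  set B : R → R → H' →L[𝕜] H' := fun x y => Φ (ketBra 𝕜 (a x) (a y)) with hB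
  have hpos : ∀ {n : ℕ} (v : Fin n → R), (blockOp fun i j => B (v i) (v j)).IsPositive :=
    fun v => hΦ.1 _ _ (blockOp_rankOne_isPositive fun i => a (v i))
  have hd : ∀ x, B x x = rankOne 𝕜 (b x) (b x) := fun x => congrArg Subtype.val (h x)
  have hrank : ∀ x y, B x y = ⟪b x, B x y (b y)⟫_𝕜 • rankOne 𝕜 (b x) (b y) := fun x y =>
    eq_smul_rankOne_of_blockOp_isPositive (hpos ![x, y]) (hb x) (hb y) (hd x) (hd y)
  have hsymm : ∀ x y u v, ⟪B x y u, v⟫_𝕜 = ⟪u, B y x v⟫_𝕜 := fun x y =>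
    ((blockOp_isPositive_iff _).1 (hpos ![x, y])).1 0 1
  -- The arguments are swapped because the trace of `a y a x*` is `⟪a x, a y⟫`; conjugated
  -- coefficients below undo the swap.
  refine ⟨fun x y => ⟪b y, B y x (b x)⟫_𝕜, ⟨?_, fun c => ?_⟩, fun x y => ?_⟩
  · ext x y
    simp [hsymm]
  · have e := c.support.equivFin.symm
    have h1 := (hpos fun i => (e i : R)).inner_nonneg_right
      (WithLp.toLp 2 fun i => starRingEnd 𝕜 (c (e i)) • b (e i))
    rw [inner_blockOp, Finset.sum_comm] at h1
    have hsum : ∀ F : R → 𝕜, ∑ i, F (e i) = ∑ i ∈ c.support, F i := fun F =>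
      (e.sum_comp fun i : c.support => F i).trans (Finset.sum_coe_sort c.support F)
    refine h1.trans_eq ?_
    simp only [Finsupp.sum, ← hsum]
    refine Finset.sum_congr rfl fun i _ => Finset.sum_congr rfl fun j _ => ?_
    simp [inner_smul_left, inner_smul_right]
    ring
  · have h1 := hΦ.2 (ketBra 𝕜 (a y) (a x))
    have h2 : trace (B y x) = ⟪b x, b y⟫_𝕜 * ⟪b y, B y x (b x)⟫_𝕜 := by
      have h2 := trace_rankOne (𝕜 := 𝕜) (⟪b y, B y x (b x)⟫_𝕜 • b y) (b x)
      rwa [map_smul, smul_apply, ← hrank, inner_smul_right, mul_comm] at h2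
    rw [← h2]
    exact (trace_rankOne _ _).symm.trans h1.symm

end CPTPKernel

theorem mainTheorem11 {𝕜 : Type*} [RCLike 𝕜]
    {H : Type*} [NormedAddCommGroup H] [InnerProductSpace 𝕜 H] [CompleteSpace H]
    {H' : Type*} [NormedAddCommGroup H'] [InnerProductSpace 𝕜 H'] [CompleteSpace H']
    {R : Type*} [Nonempty R] (a : R → H) (b : R → H')
    (ha : ∀ x, ‖a x‖ = 1) (hb : ∀ x, ‖b x‖ = 1)
    (ka kb : R → R → 𝕜)
    (hka : ∀ x x', ka x x' = ⟪a x, a x'⟫_𝕜) (hkb : ∀ x x', kb x x' = ⟪b x, b x'⟫_𝕜) :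
    ((∃ Φ : CPTPKernel.traceClass 𝕜 H →ₗ[𝕜] CPTPKernel.traceClass 𝕜 H',
        CPTPKernel.IsCPTP Φ ∧ ∀ x, Φ (CPTPKernel.dyad 𝕜 (a x)) = CPTPKernel.dyad 𝕜 (b x)) ↔
      ∃ kt : R → R → 𝕜, CPTPKernel.IsPosDefKernel kt ∧ ∀ x x', ka x x' = kb x x' * kt x x') ∧
    (∀ kt : R → R → 𝕜, CPTPKernel.IsPosDefKernel kt → (∀ x x', ka x x' = kb x x' * kt x x') →
      (∀ x, kt x x = 1) ∧
      ∀ [TopologicalSpace R], Continuous (fun p : R × R => ka p.1 p.2) →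
        Continuous (fun p : R × R => kb p.1 p.2) → Continuous (fun p : R × R => kt p.1 p.2)) := by
  obtain rfl : ka = fun x x' => ⟪a x, a x'⟫_𝕜 := by ext; apply hka
  obtain rfl : kb = fun x x' => ⟪b x, b x'⟫_𝕜 := by ext; apply hkb
  have hb1 : ∀ x, ⟪b x, b x⟫_𝕜 = 1 := fun x => by simp [inner_self_eq_norm_sq_to_K, hb]
  have hdiag : ∀ kt : R → R → 𝕜, (∀ x x', ⟪a x, a x'⟫_𝕜 = ⟪b x, b x'⟫_𝕜 * kt x x') →
      ∀ x, kt x x = 1 := fun kt h x => by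
    have := h x x
    rwa [hb1, one_mul, inner_self_eq_norm_sq_to_K, ha, RCLike.ofReal_one, one_pow, eq_comm] at this
  refine ⟨⟨fun ⟨Φ, hΦ, h⟩ => CPTPKernel.exists_isPosDefKernel_of_isCPTP hb hΦ h,
    fun ⟨kt, hkt, h⟩ => ?_⟩, fun kt hkt h => ⟨hdiag kt h, fun hka' hkb' => ?_⟩⟩
  · obtain ⟨ι, c, hc⟩ := CPTPKernel.exists_feature_map hkt
    refine CPTPKernel.exists_isCPTP_of_inner_eq_mul hb (c := c) (fun x => ?_) fun x y => ?_
    · rw [@norm_eq_sqrt_re_inner 𝕜, hc, hdiag kt h]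
      simp
    · rw [hc]
      exact h x y
  · obtain ⟨ι, c, hc⟩ := CPTPKernel.exists_feature_map hkt
    exact CPTPKernel.continuous_of_inner_eq hc (hdiag kt h) hb1 h hka' hkb'
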